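/- Literals over a set of variables are the variables $v$ and their complements $\overline{v}$. A clause is a finite set of literals containing no complementary pair; a multi-clause-set $F$ is a finite multiset of clauses (a clause-set is the special case where all multiplicities are $1$). Let $\mathrm{var}(F)$ be the set of variables occurring (in either sign) in $F$, let $n(F)=|\mathrm{var}(F)|$, let $c(F)$ be the number of clauses counted with multiplicity, and let $\delta(F)=c(F)-n(F)$ be the deficiency. The literal degree $\mathrm{ld}_F(x)$ is the number of clauses of $F$ (with multiplicity) containing the literal $x$, the variable degree is $\mathrm{vd}_F(v)=\mathrm{ld}_F(v)+\mathrm{ld}_F(\overline{v})$, and $\mathrm{minvdeg}(F)=\min_{v\in\mathrm{var}(F)}\mathrm{vd}_F(v)$ (and $+\infty$ if $n(F)=0$). For a finite set $V$ of variables, $F[V]$ is the multi-clause-set obtained from $F$ by removing all clauses that contain no variable from $V$, and removing from the remaining clauses all literals whose variable is not in $V$ (multiplicities being added up). If $n(F)>0$, the surplus is $\sigma(F)=\min\{\delta(F[V]) : \emptyset\neq V\subseteq\mathrm{var}(F)\}$. An autarky for $F$ is an assignment $\varphi$ of truth values to a finite set of variables such that every clause of $F$ containing a variable assigned by $\varphi$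 contains a literal made true by $\varphi$; it is trivial if it assigns no variable of $F$. $F$ is lean if it has no non-trivial autarky. Let $\mathrm{nM}(1)=2$ and $\mathrm{nM}(k)=\max_{2\le i\le k}\min\bigl(2i,\ \mathrm{nM}(k-i+1)+i\bigr)$ for integers $k\ge 2$. **Theorem.** Let $F$ be a lean multi-clause-set with $n(F)>0$. Then $1\le\sigma(F)\le\delta(F)$ and $$\mathrm{minvdeg}(F)\le \mathrm{nM}(\sigma(F)).$$ More precisely, there is a variable $v\in\mathrm{var}(F)$ with $\mathrm{vd}_F(v)\le \mathrm{nM}(\sigma(F))$ and with $\mathrm{ld}_F(v)\le\sigma(F)$ and $\mathrm{ld}_F(\overline{v})\le\sigma(F)$. Furthermore $$\sigma(F)+1\le\mathrm{minvdeg}(F)\le\mathrm{nM}(\sigma(F))\le\sigma(F)+1+\lfloor\log_2\sigma(F)\rfloor,$$ $$\mathrm{minvdeg}(F)\le\mathrm{nM}(\delta(F))\le\delta(F)+1+\lfloor\log_2\delta(F)\rfloor.$$ -/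

import Mathlib

namespace ClauseSets

/-- A literal over the set `V` of variables: a variable together with a sign
(`true` for the positive literal `v`, `false` for its complement). -/
@[ext]
structure Literal (V : Type*) where
  var : V
  positive : Bool
  deriving DecidableEq

namespace Literal

variable {V : Type*}

/-- The complement of a literal. -/
def compl (x : Literal V) : Literal V := ⟨x.var, !x.positive⟩

/-- The positive literal of a variable. -/
def pos (v : V) : Literal V := ⟨v, true⟩

/-- The negative literal of a variable. -/
def neg (v : V) : Literal V := ⟨v, false⟩

end Literal

/-- A clause is a finite and clash-free set of literals. -/
@[ext]
structure Clause (V : Type*) where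
  lits : Finset (Literal V)
  clashFree : ∀ x ∈ lits, x.compl ∉ lits

instance {V : Type*} [DecidableEq V] : DecidableEq (Clause V) := fun C D =>
  decidable_of_iff (C.lits = D.lits) Clause.ext_iff.symm

namespace Clause

variable {V : Type*} [DecidableEq V]

/-- The set of variables of a clause. -/
def vars (C : Clause V) : Finset V := C.lits.image Literal.var

/-- The clause consisting of the literals of `C` whose underlying variable is in `W`. -/
def restrict (C : Clause V) (W : Finset V) : Clause V where
  lits := C.lits.filter fun x => x.var ∈ W
  clashFree := fun x hx hx' =>
    C.clashFree x (Finset.mem_filter.1 hx).1 (Finset.mem_filter.1 hx').1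

end Clause

/-- A multi-clause-set: clauses with multiplicities, only finitely many of them non-zero.
A clause-set `F : Finset (Clause V)` is the multi-clause-set `F.val`. -/
abbrev MultiClauseSet (V : Type*) := Multiset (Clause V)

/-- A partial assignment: a map from a finite set of variables to `{0, 1}`
(the value `none` stands for "not assigned"). -/
structure PartialAssignment (V : Type*) where
  toFun : V → Option Bool
  finite_dom : {v | toFun v ≠ none}.Finite

namespace PartialAssignment

variable {V : Type*} [DecidableEq V]

/-- The set of variables to which a value is assigned. -/
def dom (φ : PartialAssignment V) : Set V := {v | φ.toFun v ≠ none}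

/-- The literal `x` is set to `1`. -/
def SetsTrue (φ : PartialAssignment V) (x : Literal V) : Prop :=
  φ.toFun x.var = some x.positive

/-- The clause `C` is satisfied, i.e. some literal of `C` is set to `1`. -/
def Satisfies (φ : PartialAssignment V) (C : Clause V) : Prop :=
  ∃ x ∈ C.lits, φ.SetsTrue x

/-- The clause `C` is touched, i.e. some variable of `C` is assigned. -/
def Touches (φ : PartialAssignment V) (C : Clause V) : Prop :=
  ∃ v ∈ C.vars, v ∈ φ.dom

end PartialAssignment

namespace MultiClauseSet

variable {V : Type*} [DecidableEq V]

/-- The set of variables of a multi-clause-set. -/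
def vars (F : MultiClauseSet V) : Finset V := F.toFinset.biUnion Clause.vars

/-- `n(F)`, the number of variables. -/
def numVars (F : MultiClauseSet V) : ℕ := (vars F).card

/-- `c(F)`, the number of clauses, counted with multiplicities. -/
def numClauses (F : MultiClauseSet V) : ℕ := Multiset.card F

/-- The deficiency `δ(F) = c(F) - n(F)`. -/
def deficiency (F : MultiClauseSet V) : ℤ := (numClauses F : ℤ) - (numVars F : ℤ)

/-- The restriction `F[W]`: remove the clauses having no variable in `W`, and remove from the
remaining clauses all literals whose variable is not in `W`; multiplicities are added up. -/
def restrict (F : MultiClauseSet V) (W : Finset V) : MultiClauseSet V :=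
  (F.filter fun C => (C.vars ∩ W).Nonempty).map fun C => C.restrict W

theorem powerset_erase_empty_nonempty {s : Finset V} (h : s.Nonempty) :
    (s.powerset.erase ∅).Nonempty :=
  ⟨s, Finset.mem_erase.2 ⟨h.ne_empty, Finset.mem_powerset_self s⟩⟩

/-- The surplus `σ(F)`: the minimum of `δ(F[W])` over all non-empty sets `W` of variables of `F`
(and `0` if `F` has no variables). -/
def surplus (F : MultiClauseSet V) : ℤ :=
  if h : (vars F).Nonempty then
    ((vars F).powerset.erase ∅).inf' (powerset_erase_empty_nonempty h)
      fun W => deficiency (restrict F W)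
  else 0

/-- The literal-degree: the number of occurrences of the literal `x` in `F`. -/
def litDeg (F : MultiClauseSet V) (x : Literal V) : ℕ := F.countP fun C => x ∈ C.lits

/-- The variable-degree of `v`: the sum of the two literal-degrees. -/
def varDeg (F : MultiClauseSet V) (v : V) : ℕ :=
  litDeg F (Literal.pos v) + litDeg F (Literal.neg v)

/-- The minimum variable-degree (`⊤`, i.e. `+∞`, if `F` has no variables). -/
noncomputable def minVarDeg (F : MultiClauseSet V) : ℕ∞ := (vars F).inf fun v => (varDeg F v : ℕ∞)

/-- An autarky for `F` is a partial assignment satisfying every clause of `F` it touches. -/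
def IsAutarky (F : MultiClauseSet V) (φ : PartialAssignment V) : Prop :=
  ∀ C ∈ F, φ.Touches C → φ.Satisfies C

/-- An autarky is trivial if it assigns no variable of `F`; `F` is lean if it has no non-trivial
autarky. -/
def IsAutarkyFree (F : MultiClauseSet V) : Prop :=
  ∀ φ : PartialAssignment V, IsAutarky F φ → ∀ v ∈ vars F, v ∉ φ.dom

end MultiClauseSet

/-- The non-Mersenne numbers: `nM(1) = 2`, and
`nM(k) = max_{2 ≤ i ≤ k} min (2 i, nM(k - i + 1) + i)` for `k ≥ 2`
(`k = 0` is not used; the value there is arbitrary). -/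
def nonMersenne (k : ℕ) : ℕ :=
  if k ≤ 1 then 2
  else (Finset.Icc 2 k).attach.sup fun i => min (2 * i.1) (nonMersenne (k - i.1 + 1) + i.1)
termination_by k
decreasing_by
  have := Finset.mem_Icc.1 i.2
  omega

end ClauseSets

/-!
Only the pattern of signs matters, so a multi-clause-set is treated as a matrix with a row for each
clause occurrence, a column for each variable, and entries in `Option Bool`. The number of rows
with an entry in a column set `W`, minus the size of `W`, is then `δ(F[W])`.

By Hall's theorem, leanness forces this number to be positive for non-empty `W`: in a smallest
counterexample the touched rows could be matched to distinct variables and so all be satisfied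
(`NoAutarky.card_lt_card_touched`).

For the upper bound, choose `W` attaining the surplus `k` and restrict to `W`. Filling empty entries
as long as leanness persists can only increase degrees, and it changes neither the number of rows
nor of columns. In the resulting saturated matrix let `v` have minimum degree. If `v` is the only
column, its degree is at most `k + 1`, and both literals of `v` occur by leanness. Otherwise, making
either literal of `v` true gives a lean matrix again (`IsSaturated.noAutarky_assign`). If the
literal made true occurs in `i` rows, the deficiency becomes at most `k + 1 - i`, so `i ≤ k`, and by
induction some column has degree at most `nM(k + 1 - i)`; before the assignment, its degree was at
most `nM(k + 1 - i) + i`. With `i` the larger of the two literal degrees of `v`, the degree of `v`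
is thus at most both `2 i` and `nM(k + 1 - i) + i`, whence at most `nM(k)`: by definition if
`i ≥ 2`, and as `nM(k) ≥ 2` otherwise (`NoAutarky.exists_degree_le`). What remains is the
monotonicity and the logarithmic bound of `nM`, which follow from the recursion, and the lower
bound, which follows from `δ(F[{v}]) = vd(v) - 1`.
-/

/-! ### The non-Mersenne numbers -/

namespace ClauseSets

theorem nonMersenne_of_le_one {k : ℕ} (h : k ≤ 1) : nonMersenne k = 2 := by
  rw [nonMersenne, if_pos h]

theorem nonMersenne_le_iff {k : ℕ} (h : 2 ≤ k) (m : ℕ) :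
    nonMersenne k ≤ m ↔
      ∀ i, 2 ≤ i → i ≤ k → min (2 * i) (nonMersenne (k - i + 1) + i) ≤ m := by
  rw [nonMersenne, if_neg (by omega), Finset.sup_le_iff]
  constructor
  · intro H i h2 hk
    exact H ⟨i, Finset.mem_Icc.2 ⟨h2, hk⟩⟩ (Finset.mem_attach _ _)
  · rintro H ⟨i, hi⟩ -
    exact H i (Finset.mem_Icc.1 hi).1 (Finset.mem_Icc.1 hi).2

theorem min_le_nonMersenne {k i : ℕ} (h2 : 2 ≤ i) (hk : i ≤ k) :
    min (2 * i) (nonMersenne (k - i + 1) + i) ≤ nonMersenne k :=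
  (nonMersenne_le_iff (h2.trans hk) _).1 le_rfl i h2 hk

theorem succ_le_nonMersenne {k : ℕ} (hk : 1 ≤ k) : k + 1 ≤ nonMersenne k := by
  rcases hk.eq_or_lt with rfl | hk
  · rw [nonMersenne_of_le_one le_rfl]
  · have h := min_le_nonMersenne hk (le_refl k)
    rw [Nat.sub_self, zero_add, nonMersenne_of_le_one le_rfl] at h
    omega

theorem two_le_nonMersenne (k : ℕ) : 2 ≤ nonMersenne k := by
  rcases le_or_gt k 1 with h | h
  · rw [nonMersenne_of_le_one h]
  · have := succ_le_nonMersenne h.le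
    omega

theorem nonMersenne_le_succ (k : ℕ) : nonMersenne k ≤ nonMersenne (k + 1) := by
  induction k using Nat.strong_induction_on with
  | _ k ih =>
    rcases le_or_gt k 1 with h | h
    · rw [nonMersenne_of_le_one h]
      exact two_le_nonMersenne _
    · rw [nonMersenne_le_iff h]
      intro i h2 hik
      refine le_trans ?_ (min_le_nonMersenne h2 (hik.trans k.le_succ))
      have := ih (k - i + 1) (by omega)
      rw [show k + 1 - i + 1 = k - i + 1 + 1 by omega]
      omega

theorem nonMersenne_mono : Monotone nonMersenne := monotone_nat_of_le_succ nonMersenne_le_succ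

theorem nonMersenne_le_log {k : ℕ} (hk : 1 ≤ k) : nonMersenne k ≤ k + 1 + Nat.log 2 k := by
  induction k using Nat.strong_induction_on with
  | _ k ih =>
    rcases hk.eq_or_lt with rfl | hk
    · simp [nonMersenne_of_le_one]
    · rw [nonMersenne_le_iff hk]
      intro i h2 hik
      have hlog : 1 ≤ Nat.log 2 k := Nat.log_pos (by norm_num) hk
      by_cases hi : 2 * i ≤ k + 1 + Nat.log 2 k
      · exact (min_le_left _ _).trans hi
        -- Here `k + 2 < 2 * i`, so the recursive value is taken at an argument of at most `k / 2`.
      · refine (min_le_right _ _).trans ?_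
        have h1 := ih (k - i + 1) (by omega) (by omega)
        have h3 : Nat.log 2 (k - i + 1) ≤ Nat.log 2 (k / 2) := Nat.log_mono_right (by omega)
        rw [Nat.log_div_base] at h3
        omega

/-! ### Clause matrices: leanness and Hall's theorem -/

namespace ClauseMatrix

variable {ι V : Type*}

/-- The rows in `I` that have an entry in some column of `W`, for a clause matrix `M`: row `i` is
a clause, and `M i v = some b` says that it contains the literal of the variable `v` made true by
the value `b`. -/
def touched (M : ι → V → Option Bool) (I : Finset ι) (W : Finset V) : Finset ι :=
  I.filter fun i => ∃ v ∈ W, M i v ≠ none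

/-- The literal degree of `v` with sign `b` among the rows in `I`. -/
def litDegree (M : ι → V → Option Bool) (I : Finset ι) (v : V) (b : Bool) : ℕ :=
  (I.filter fun i => M i v = some b).card

/-- The variable degree of `v` among the rows in `I`. -/
def degree (M : ι → V → Option Bool) (I : Finset ι) (v : V) : ℕ :=
  (I.filter fun i => M i v ≠ none).card

/-- Leanness of the clause matrix with rows `I` and columns `S`: no assignment `f` on a non-empty
set `A` of columns satisfies every row having an entry in `A`. A column of `S` without entries
thus violates leanness. -/
def NoAutarky (M : ι → V → Option Bool) (I : Finset ι) (S : Finset V) : Prop :=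
  ∀ A ⊆ S, A.Nonempty → ∀ f : V → Bool,
    ∃ i ∈ I, (∃ v ∈ A, M i v ≠ none) ∧ ∀ v ∈ A, M i v ≠ some (f v)

variable {M : ι → V → Option Bool} {I : Finset ι} {S : Finset V}

theorem mem_touched {W : Finset V} {i : ι} :
    i ∈ touched M I W ↔ i ∈ I ∧ ∃ v ∈ W, M i v ≠ none := by
  simp [touched]

theorem degree_eq_add [DecidableEq ι] (v : V) (b : Bool) :
    degree M I v = litDegree M I v b + litDegree M I v (!b) := by
  unfold degree litDegree
  rw [← Finset.card_union_of_disjoint]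
  · congr 1
    ext i
    rcases h : M i v with _ | c
    · simp [h]
    · cases b <;> cases c <;> simp [h]
  · rw [Finset.disjoint_filter]
    intro i _ h1 h2
    rw [h1] at h2
    cases b <;> simp at h2

/-- Lean matrices have surplus at least one. For a smallest violating `W`, the entries in `W`
satisfy Hall's condition, as a violation of it would leave a smaller violating set; so the rows
touching `W` can be satisfied by means of pairwise different variables. -/
theorem NoAutarky.card_lt_card_touched [DecidableEq ι] [DecidableEq V] (h : NoAutarky M I S)
    {W : Finset V} (hW : W ⊆ S) (hne : W.Nonempty) : W.card < (touched M I W).card := by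
  induction hn : W.card using Nat.strong_induction_on generalizing W with
  | _ n ih =>
    subst hn
    by_contra hlt
    push Not at hlt
    let t : (touched M I W) → Finset V := fun i => W.filter fun v => M i v ≠ none
    by_cases hall : ∀ s : Finset (touched M I W), s.card ≤ (s.biUnion t).card
    · obtain ⟨g, hg, hgt⟩ := (Finset.all_card_le_biUnion_card_iff_exists_injective t).1 hall
      let f : V → Bool := fun v =>
        if hv : ∃ i, g i = v then (M hv.choose v).getD true else true
      obtain ⟨i, hiI, hi, hun⟩ := h W hW hne f
      let j : touched M I W := ⟨i, mem_touched.2 ⟨hiI, hi⟩⟩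
      have hj := Finset.mem_filter.1 (hgt j)
      refine hun (g j) hj.1 ?_
      have hex : ∃ l, g l = g j := ⟨j, rfl⟩
      have hch : hex.choose = j := hg hex.choose_spec
      obtain ⟨b, hb⟩ := Option.ne_none_iff_exists'.1 hj.2
      have hf : f (g j) = b := by
        simp only [f]
        rw [dif_pos hex, hch, hb]
        rfl
      rw [hf]
      exact hb
    · push Not at hall
      obtain ⟨s, hs⟩ := hall
      have hBW : s.biUnion t ⊆ W := by
        intro v hv
        obtain ⟨i, -, hv⟩ := Finset.mem_biUnion.1 hv
        exact (Finset.mem_filter.1 hv).1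
      have hsub : touched M I (W \ s.biUnion t) ⊆
          touched M I W \ s.map (Function.Embedding.subtype _) := by
        intro i hi
        obtain ⟨hiI, v, hv, hiv⟩ := mem_touched.1 hi
        obtain ⟨hvW, hvB⟩ := Finset.mem_sdiff.1 hv
        refine Finset.mem_sdiff.2 ⟨mem_touched.2 ⟨hiI, v, hvW, hiv⟩, fun hmem => hvB ?_⟩
        obtain ⟨j, hj, rfl⟩ := Finset.mem_map.1 hmem
        exact Finset.mem_biUnion.2 ⟨j, hj, Finset.mem_filter.2 ⟨hvW, hiv⟩⟩
      have hsT : s.map (Function.Embedding.subtype _) ⊆ touched M I W := by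
        intro i hi
        obtain ⟨j, -, rfl⟩ := Finset.mem_map.1 hi
        exact j.2
      have h1 := Finset.card_le_card hsub
      rw [Finset.card_sdiff_of_subset hsT, Finset.card_map] at h1
      have h2 := Finset.card_sdiff_of_subset hBW
      have h3 := Finset.card_le_card hBW
      have h4 := Finset.card_le_card hsT
      rw [Finset.card_map] at h4
      have hUne : (W \ s.biUnion t).Nonempty := Finset.card_pos.1 (by omega)
      obtain ⟨j, hj⟩ : s.Nonempty := Finset.card_pos.1 (by omega)
      have hBne : 0 < (s.biUnion t).card := by
        obtain ⟨-, v, hv, hjv⟩ := mem_touched.1 j.2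
        exact Finset.card_pos.2
          ⟨v, Finset.mem_biUnion.2 ⟨j, hj, Finset.mem_filter.2 ⟨hv, hjv⟩⟩⟩
      have := ih _ (by omega) (Finset.sdiff_subset.trans hW) hUne rfl
      omega

/-! ### Saturation -/

/-- The clause matrix obtained by adding to row `i` the literal of `v` with sign `b`. -/
def insertLit [DecidableEq ι] [DecidableEq V] (M : ι → V → Option Bool) (i : ι) (v : V) (b : Bool) :
    ι → V → Option Bool :=
  fun j u => if j = i ∧ u = v then some b else M j u

/-- A lean clause matrix is saturated if filling any empty entry destroys leanness. -/
structure IsSaturated [DecidableEq ι] [DecidableEq V] (M : ι → V → Option Bool) (I : Finset ι)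
    (S : Finset V) : Prop where
  noAutarky : NoAutarky M I S
  not_noAutarky_insertLit :
    ∀ i ∈ I, ∀ v ∈ S, M i v = none → ∀ b, ¬ NoAutarky (insertLit M i v b) I S

theorem NoAutarky.exists_isSaturated [DecidableEq ι] [DecidableEq V] (h : NoAutarky M I S) :
    ∃ N : ι → V → Option Bool,
      (∀ i v b, M i v = some b → N i v = some b) ∧ IsSaturated N I S := by
  induction hn : ((I ×ˢ S).filter fun p => M p.1 p.2 = none).card
    using Nat.strong_induction_on generalizing M with
  | _ n ih =>
    by_cases hs : IsSaturated M I S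
    · exact ⟨M, fun _ _ _ h => h, hs⟩
    · have : ∃ i ∈ I, ∃ v ∈ S, M i v = none ∧ ∃ b, NoAutarky (insertLit M i v b) I S := by
        by_contra hcon
        push Not at hcon
        exact hs ⟨h, hcon⟩
      obtain ⟨i, hi, v, hv, hiv, b, hl⟩ := this
      obtain ⟨N, hN, hNs⟩ := ih _ (by
        rw [← hn]
        refine Finset.card_lt_card ((Finset.ssubset_iff_of_subset ?_).2
          ⟨(i, v), by simp [hi, hv, hiv], fun hmem => ?_⟩)
        · intro p hp
          obtain ⟨hp1, hp2⟩ := Finset.mem_filter.1 hp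
          refine Finset.mem_filter.2 ⟨hp1, ?_⟩
          unfold insertLit at hp2
          split_ifs at hp2
          exact hp2
        · have := (Finset.mem_filter.1 hmem).2
          simp [insertLit] at this) hl rfl
      refine ⟨N, fun j u c hju => hN j u c ?_, hNs⟩
      rw [insertLit, if_neg, hju]
      rintro ⟨rfl, rfl⟩
      simp [hiv] at hju

/-- Assigning a variable of minimum degree in a saturated lean matrix keeps it lean. An autarky of
the rest combines with an autarky that becomes available on adding to a touched row the literal
made true; if no touched row admits this, all touched rows contain `v`, and minimality of the
degree of `v` forces the converse, so that extending the autarky by `v` satisfies all of them. -/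
theorem IsSaturated.noAutarky_assign [DecidableEq ι] [DecidableEq V] (h : IsSaturated M I S) {v : V}
    (hv : v ∈ S) (hmin : ∀ w ∈ S, degree M I v ≤ degree M I w) (b : Bool) :
    NoAutarky M (I.filter fun i => M i v ≠ some b) (S.erase v) := by
  intro A hAS hA f
  by_contra hcon
  push Not at hcon
  have hsat : ∀ i ∈ I, M i v ≠ some b → (∃ a ∈ A, M i a ≠ none) →
      ∃ a ∈ A, M i a = some (f a) :=
    fun i hi hib hia => hcon i (Finset.mem_filter.2 ⟨hi, hib⟩) hia
  have hvA : v ∉ A := fun hvA => Finset.notMem_erase v S (hAS hvA)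
  have hAS' : A ⊆ S := hAS.trans (Finset.erase_subset _ _)
  by_cases hex : ∃ i ∈ I, M i v = none ∧ ∃ a ∈ A, M i a ≠ none
  · obtain ⟨i, hi, hiv, hiA⟩ := hex
    have hnl := h.not_noAutarky_insertLit i hi v hv hiv b
    unfold NoAutarky at hnl
    push Not at hnl
    obtain ⟨B, hBS, hB, g, hg⟩ := hnl
    have hother : ∀ j u, ¬ (j = i ∧ u = v) → insertLit M i v b j u = M j u :=
      fun j u hju => if_neg hju
    have hself : insertLit M i v b i v = some b := if_pos ⟨rfl, rfl⟩
    by_cases hvB : v ∈ B ∧ g v = b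
    · obtain ⟨j, hj, ⟨u, hu, hju⟩, hun⟩ := h.noAutarky (A ∪ B) (Finset.union_subset hAS' hBS)
        (hA.mono Finset.subset_union_left) (fun w => if w ∈ A then f w else g w)
      have hjb : M j v ≠ some b := by
        have := hun v (Finset.mem_union_right _ hvB.1)
        rwa [if_neg hvA, hvB.2] at this
      have hjA : ∀ a ∈ A, M j a = none := by
        by_contra hjA
        push Not at hjA
        obtain ⟨a, ha, hja⟩ := hsat j hj hjb hjA
        have := hun a (Finset.mem_union_left _ ha)
        rw [if_pos ha] at this
        exact this hja
      have hji : j ≠ i := by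
        rintro rfl
        obtain ⟨a, ha, hia⟩ := hiA
        exact hia (hjA a ha)
      have huB : u ∈ B :=
        (Finset.mem_union.1 hu).resolve_left fun huA => hju (hjA u huA)
      obtain ⟨w, hwB, hw⟩ := hg j hj ⟨u, huB, by rwa [hother j u fun hh => hji hh.1]⟩
      rw [hother j w fun hh => hji hh.1] at hw
      have hwA : w ∉ A := fun hwA => by simp [hjA w hwA] at hw
      have := hun w (Finset.mem_union_right _ hwB)
      rw [if_neg hwA] at this
      exact this hw
      -- Without `v ↦ b`, the autarky `g` does not profit from the additional literal.
    · obtain ⟨j, hj, ⟨u, hu, hju⟩, hun⟩ := h.noAutarky B hBS hB g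
      obtain ⟨w, hwB, hw⟩ := hg j hj ⟨u, hu, by
        by_cases hh : j = i ∧ u = v
        · rw [hh.1, hh.2, hself]
          simp
        · rwa [hother j u hh]⟩
      by_cases hh : j = i ∧ w = v
      · rw [hh.1, hh.2, hself] at hw
        exact hvB ⟨hh.2 ▸ hwB, (Option.some_injective _ hw).symm⟩
      · rw [hother j w hh] at hw
        exact hun w hwB hw
  · push Not at hex
    obtain ⟨a, ha⟩ := hA
    have hsub : (I.filter fun i => M i a ≠ none) ⊆ I.filter fun i => M i v ≠ none := by
      intro i hi
      obtain ⟨hi, hia⟩ := Finset.mem_filter.1 hi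
      exact Finset.mem_filter.2 ⟨hi, fun hiv => hia (hex i hi hiv a ha)⟩
    have heq := Finset.eq_of_subset_of_card_le hsub (hmin a (hAS' ha))
    obtain ⟨j, hj, ⟨u, hu, hju⟩, hun⟩ := h.noAutarky (insert v A)
      (Finset.insert_subset hv hAS') (Finset.insert_nonempty _ _)
      (fun w => if w = v then b else f w)
    have hjb : M j v ≠ some b := by
      have := hun v (Finset.mem_insert_self _ _)
      rwa [if_pos rfl] at this
    have hjv : M j v ≠ none := by
      rcases Finset.mem_insert.1 hu with rfl | hu
      · exact hju
      · exact fun hjv => hju (hex j hj hjv u hu)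
    have hja : M j a ≠ none := by
      have : j ∈ I.filter fun i => M i a ≠ none := heq ▸ Finset.mem_filter.2 ⟨hj, hjv⟩
      exact (Finset.mem_filter.1 this).2
    obtain ⟨c, hc, hjc⟩ := hsat j hj hjb ⟨a, ha, hja⟩
    have := hun c (Finset.mem_insert_of_mem hc)
    rw [if_neg (by rintro rfl; exact hvA hc)] at this
    exact this hjc

/-! ### A variable of small degree -/

/-- If `W` attains the surplus `k`, then restricting to `W` and saturating changes neither the
number of rows nor of columns, so the deficiency stays `k`; assigning a variable of minimum degree
so as to satisfy `i` rows leaves a lean matrix of deficiency at most `k + 1 - i`. -/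
theorem NoAutarky.exists_degree_le [DecidableEq ι] [DecidableEq V] (h : NoAutarky M I S) {k : ℕ}
    {W : Finset V} (hW : W ⊆ S)
    (hne : W.Nonempty) (hk : (touched M I W).card ≤ W.card + k) :
    ∃ v ∈ S, degree M I v ≤ nonMersenne k ∧ ∀ b, litDegree M I v b ≤ k := by
  induction hn : W.card using Nat.strong_induction_on generalizing M I S W k with
  | _ n ih =>
    subst hn
    have hk1 : 1 ≤ k := by
      have := h.card_lt_card_touched hW hne
      omega
    -- Rows without entry in `W` are discarded, as saturation would fill them.
    have hlean : NoAutarky M (touched M I W) W := by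
      intro A hA hAne f
      obtain ⟨i, hi, ⟨v, hv, hiv⟩, hun⟩ := h A (hA.trans hW) hAne f
      exact ⟨i, mem_touched.2 ⟨hi, v, hA hv, hiv⟩, ⟨v, hv, hiv⟩, hun⟩
    obtain ⟨N, hMN, hsat⟩ := hlean.exists_isSaturated
    set J := touched M I W
    obtain ⟨v, hvW, hmin⟩ := W.exists_min_image (degree N J) hne
    have hassign : ∀ b, (J.filter fun i => N i v ≠ some b).card + litDegree N J v b = J.card :=
      fun b => by
        rw [add_comm, litDegree]
        exact Finset.card_filter_add_card_filter_not _
    have hassign_le : ∀ b, (touched N (J.filter fun i => N i v ≠ some b) (W.erase v)).card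
        + litDegree N J v b ≤ W.card + k := fun b => by
      have h1 := Finset.card_filter_le (J.filter fun i => N i v ≠ some b)
        (fun i => ∃ w ∈ W.erase v, N i w ≠ none)
      have h2 := hassign b
      unfold touched
      omega
    have hWv : (W.erase v).card + 1 = W.card := Finset.card_erase_add_one hvW
    -- Otherwise, the assignment on `v` alone that makes the occurring sign true is an autarky.
    have hpos : ∀ b, 1 ≤ litDegree N J v b := by
      intro b
      obtain ⟨i, hi, ⟨w, hw, hiw⟩, hun⟩ := hsat.noAutarky {v} (by simpa using hvW)
        (Finset.singleton_nonempty v) (fun _ => !b)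
      rw [Finset.mem_singleton] at hw
      subst hw
      refine Finset.card_pos.2 ⟨i, Finset.mem_filter.2 ⟨hi, ?_⟩⟩
      have := hun w (Finset.mem_singleton_self w)
      rcases hc : N i w with _ | c
      · exact absurd hc hiw
      · rw [hc] at this
        cases b <;> cases c <;> simp_all
    have hdJ : degree N J v ≤ J.card := Finset.card_filter_le _ _
    have key : degree N J v ≤ nonMersenne k ∧ ∀ b, litDegree N J v b ≤ k := by
      rcases (W.erase v).eq_empty_or_nonempty with he | hne'
      · have hd : degree N J v ≤ k + 1 := by
          rw [he, Finset.card_empty] at hWv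
          omega
        refine ⟨hd.trans (succ_le_nonMersenne hk1), fun b => ?_⟩
        have := degree_eq_add (M := N) (I := J) v b
        have := hpos (!b)
        omega
      · have hl := fun b => hsat.noAutarky_assign hvW hmin b
        have hlit : ∀ b, litDegree N J v b ≤ k := fun b => by
          have h1 := (hl b).card_lt_card_touched subset_rfl hne'
          have h2 := hassign_le b
          omega
        refine ⟨?_, hlit⟩
        obtain ⟨b, hb⟩ : ∃ b, litDegree N J v (!b) ≤ litDegree N J v b := by
          rcases le_total (litDegree N J v true) (litDegree N J v false) with h1 | h1
          · exact ⟨false, h1⟩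
          · exact ⟨true, h1⟩
        have hdeg := degree_eq_add (M := N) (I := J) v b
        rcases lt_or_ge (litDegree N J v b) 2 with hlt | h2
        · have := two_le_nonMersenne k
          omega
        · obtain ⟨w, hw, hwd, -⟩ := ih (W.erase v).card (by omega) (hl b)
            (k := k - litDegree N J v b + 1) subset_rfl hne'
            (by have := hassign_le b; have := hlit b; omega) rfl
          have hwN : degree N J w ≤
              degree N (J.filter fun i => N i v ≠ some b) w + litDegree N J v b := by
            unfold degree litDegree
            refine (Finset.card_le_card ?_).trans (Finset.card_union_le _ _)
            intro i hi
            simp only [Finset.mem_union, Finset.mem_filter] at hi ⊢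
            tauto
          have hvw := hmin w (Finset.mem_of_mem_erase hw)
          refine le_trans (le_min ?_ ?_) (min_le_nonMersenne h2 (hlit b))
          · omega
          · omega
    have hmem : ∀ i ∈ I, M i v ≠ none → i ∈ J := fun i hi hiv => mem_touched.2 ⟨hi, v, hvW, hiv⟩
    refine ⟨v, hW hvW, le_trans (Finset.card_le_card ?_) key.1,
      fun b => le_trans (Finset.card_le_card ?_) (key.2 b)⟩
    · intro i hi
      obtain ⟨hi, hiv⟩ := Finset.mem_filter.1 hi
      obtain ⟨c, hc⟩ := Option.ne_none_iff_exists'.1 hiv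
      exact Finset.mem_filter.2 ⟨hmem i hi hiv, by rw [hMN i v c hc]; simp⟩
    · intro i hi
      obtain ⟨hi, hiv⟩ := Finset.mem_filter.1 hi
      exact Finset.mem_filter.2 ⟨hmem i hi (by simp [hiv]), hMN i v b hiv⟩

end ClauseMatrix

/-! ### Multi-clause-sets as clause matrices -/

namespace MultiClauseSet

variable {V : Type*} [DecidableEq V]

/-- The sign with which the variable `v` occurs in the clause `C`, if it does. -/
def sign (C : Clause V) (v : V) : Option Bool :=
  if Literal.pos v ∈ C.lits then some true else if Literal.neg v ∈ C.lits then some false else none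

theorem sign_eq_some_iff (C : Clause V) (v : V) (b : Bool) :
    sign C v = some b ↔ (⟨v, b⟩ : Literal V) ∈ C.lits := by
  have h : Literal.pos v ∈ C.lits → Literal.neg v ∉ C.lits := C.clashFree (Literal.pos v)
  unfold sign
  by_cases h1 : Literal.pos v ∈ C.lits
  · have h2 := h h1
    rw [if_pos h1]
    cases b
    · exact ⟨fun hh => by simp at hh, fun hh => absurd hh h2⟩
    · exact ⟨fun _ => h1, fun _ => rfl⟩
  · rw [if_neg h1]
    by_cases h2 : Literal.neg v ∈ C.lits
    · rw [if_pos h2]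
      cases b
      · exact ⟨fun _ => h2, fun _ => rfl⟩
      · exact ⟨fun hh => by simp at hh, fun hh => absurd hh h1⟩
    · rw [if_neg h2]
      cases b
      · exact ⟨fun hh => by simp at hh, fun hh => absurd hh h2⟩
      · exact ⟨fun hh => by simp at hh, fun hh => absurd hh h1⟩

theorem mem_vars_clause_iff (C : Clause V) (v : V) : v ∈ C.vars ↔ sign C v ≠ none := by
  rw [Option.ne_none_iff_exists', Clause.vars, Finset.mem_image]
  constructor
  · rintro ⟨⟨u, b⟩, hx, rfl⟩
    exact ⟨b, (sign_eq_some_iff C u b).2 hx⟩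
  · rintro ⟨b, hb⟩
    exact ⟨⟨v, b⟩, (sign_eq_some_iff C v b).1 hb, rfl⟩

/-- The clause matrix of `F`, with one row for each occurrence of a clause. -/
def matrix (F : MultiClauseSet V) : F.ToType → V → Option Bool := fun i => sign (i : Clause V)

theorem countP_eq_card_filter (F : MultiClauseSet V) (p : Clause V → Prop) [DecidablePred p] :
    F.countP p = (Finset.univ.filter fun i : F.ToType => p i).card := by
  conv_lhs => rw [← Multiset.map_univ_coe F]
  rw [Multiset.countP_map]
  rfl

theorem litDeg_eq (F : MultiClauseSet V) (v : V) (b : Bool) :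
    litDeg F ⟨v, b⟩ = ClauseMatrix.litDegree (matrix F) Finset.univ v b := by
  unfold litDeg ClauseMatrix.litDegree
  rw [countP_eq_card_filter]
  congr 1
  ext i
  simp only [Finset.mem_filter, matrix, sign_eq_some_iff]

theorem varDeg_eq (F : MultiClauseSet V) (v : V) :
    varDeg F v = ClauseMatrix.degree (matrix F) Finset.univ v := by
  classical
  rw [ClauseMatrix.degree_eq_add v true, ← litDeg_eq, ← litDeg_eq]
  rfl

theorem numClauses_restrict (F : MultiClauseSet V) (W : Finset V) :
    numClauses (restrict F W) = (ClauseMatrix.touched (matrix F) Finset.univ W).card := by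
  unfold numClauses restrict ClauseMatrix.touched
  rw [Multiset.card_map, ← Multiset.countP_eq_card_filter, countP_eq_card_filter]
  congr 1
  ext i
  rw [Finset.mem_filter, Finset.mem_filter]
  simp only [matrix, Finset.Nonempty, Finset.mem_inter, mem_vars_clause_iff,
    and_comm]

theorem mem_vars_iff (F : MultiClauseSet V) (v : V) : v ∈ vars F ↔ ∃ C ∈ F, v ∈ C.vars := by
  simp [vars]

theorem vars_restrict (F : MultiClauseSet V) {W : Finset V} (hW : W ⊆ vars F) :
    vars (restrict F W) = W := by
  ext v
  simp only [mem_vars_iff, restrict, Multiset.mem_map, Multiset.mem_filter]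
  constructor
  · rintro ⟨_, ⟨C, -, rfl⟩, hv⟩
    obtain ⟨x, hx, rfl⟩ := Finset.mem_image.1 hv
    exact (Finset.mem_filter.1 hx).2
  · intro hv
    obtain ⟨C, hC, hvC⟩ := (mem_vars_iff F v).1 (hW hv)
    refine ⟨_, ⟨C, ⟨hC, v, Finset.mem_inter.2 ⟨hvC, hv⟩⟩, rfl⟩, ?_⟩
    obtain ⟨x, hx, rfl⟩ := Finset.mem_image.1 hvC
    exact Finset.mem_image.2 ⟨x, Finset.mem_filter.2 ⟨hx, hv⟩, rfl⟩

theorem deficiency_restrict (F : MultiClauseSet V) {W : Finset V} (hW : W ⊆ vars F) :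
    deficiency (restrict F W) =
      ((ClauseMatrix.touched (matrix F) Finset.univ W).card : ℤ) - W.card := by
  rw [deficiency, numClauses_restrict, numVars, vars_restrict F hW]

theorem surplus_le (F : MultiClauseSet V) {W : Finset V} (hW : W ⊆ vars F) (hne : W.Nonempty) :
    surplus F ≤ ((ClauseMatrix.touched (matrix F) Finset.univ W).card : ℤ) - W.card := by
  rw [surplus, dif_pos (hne.mono hW), ← deficiency_restrict F hW]
  exact Finset.inf'_le _ (Finset.mem_erase.2 ⟨hne.ne_empty, Finset.mem_powerset.2 hW⟩)

theorem exists_surplus_eq (F : MultiClauseSet V) (h : (vars F).Nonempty) :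
    ∃ W ⊆ vars F, W.Nonempty ∧
      surplus F = ((ClauseMatrix.touched (matrix F) Finset.univ W).card : ℤ) - W.card := by
  obtain ⟨W, hW, hs⟩ := Finset.exists_mem_eq_inf' (powerset_erase_empty_nonempty h)
    fun W => deficiency (restrict F W)
  obtain ⟨hne, hW⟩ := Finset.mem_erase.1 hW
  rw [Finset.mem_powerset] at hW
  refine ⟨W, hW, Finset.nonempty_iff_ne_empty.2 hne, ?_⟩
  rw [surplus, dif_pos h, hs, deficiency_restrict F hW]

theorem surplus_le_deficiency (F : MultiClauseSet V) (h : (vars F).Nonempty) :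
    surplus F ≤ deficiency F := by
  have h1 := surplus_le F subset_rfl h
  rw [← numClauses_restrict] at h1
  have h2 : numClauses (restrict F (vars F)) ≤ numClauses F := by
    unfold numClauses restrict
    rw [Multiset.card_map]
    exact Multiset.card_le_card (Multiset.filter_le _ _)
  unfold deficiency numVars
  omega

theorem IsAutarkyFree.noAutarky {F : MultiClauseSet V} (hF : IsAutarkyFree F) :
    ClauseMatrix.NoAutarky (matrix F) Finset.univ (vars F) := by
  intro A hA hne f
  by_contra hcon
  push Not at hcon
  let φ : PartialAssignment V :=
    { toFun := fun v => if v ∈ A then some (f v) else none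
      finite_dom := A.finite_toSet.subset fun v hv => by
        by_contra hvA
        exact hv (if_neg hvA) }
  have hdom : ∀ v, v ∈ φ.dom ↔ v ∈ A := by
    intro v
    change (if v ∈ A then some (f v) else none) ≠ none ↔ _
    by_cases hv : v ∈ A <;> simp [hv]
  obtain ⟨a, ha⟩ := hne
  refine hF φ ?_ a (hA ha) ((hdom a).2 ha)
  rintro C hC ⟨v, hvC, hv⟩
  obtain ⟨i, rfl⟩ : ∃ i : F.ToType, (i : Clause V) = C := by
    rw [← Multiset.map_univ_coe F, Multiset.mem_map] at hC
    obtain ⟨i, -, hi⟩ := hC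
    exact ⟨i, hi⟩
  obtain ⟨w, hw, hiw⟩ := hcon i (Finset.mem_univ _)
    ⟨v, (hdom v).1 hv, (mem_vars_clause_iff _ v).1 hvC⟩
  exact ⟨⟨w, f w⟩, (sign_eq_some_iff _ _ _).1 hiw, if_pos hw⟩

theorem surplus_add_one_le_varDeg (F : MultiClauseSet V) {v : V} (hv : v ∈ vars F) :
    surplus F + 1 ≤ varDeg F v := by
  have h := surplus_le F (Finset.singleton_subset_iff.2 hv) (Finset.singleton_nonempty v)
  have h2 : ClauseMatrix.touched (matrix F) Finset.univ {v} =
      Finset.univ.filter fun i => matrix F i v ≠ none := by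
    ext i
    simp [ClauseMatrix.mem_touched]
  rw [h2, Finset.card_singleton] at h
  rw [varDeg_eq, ClauseMatrix.degree]
  push_cast at h
  linarith

theorem IsAutarkyFree.one_le_surplus {F : MultiClauseSet V} (hF : IsAutarkyFree F)
    (h : (vars F).Nonempty) : 1 ≤ surplus F := by
  classical
  obtain ⟨W, hW, hne, hs⟩ := exists_surplus_eq F h
  have := hF.noAutarky.card_lt_card_touched hW hne
  omega

theorem IsAutarkyFree.exists_varDeg_le {F : MultiClauseSet V} (hF : IsAutarkyFree F)
    (h : (vars F).Nonempty) :
    ∃ v ∈ vars F, varDeg F v ≤ nonMersenne (surplus F).toNat ∧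
      (litDeg F (Literal.pos v) : ℤ) ≤ surplus F ∧ (litDeg F (Literal.neg v) : ℤ) ≤ surplus F := by
  classical
  have h1 := hF.one_le_surplus h
  obtain ⟨W, hW, hne, hs⟩ := exists_surplus_eq F h
  obtain ⟨v, hv, hd, hl⟩ := hF.noAutarky.exists_degree_le (k := (surplus F).toNat) hW hne
    (by omega)
  refine ⟨v, hv, (varDeg_eq F v).trans_le hd, ?_, ?_⟩
  · have := hl true
    rw [← litDeg_eq] at this
    change (litDeg F ⟨v, true⟩ : ℤ) ≤ _
    omega
  · have := hl false
    rw [← litDeg_eq] at this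
    change (litDeg F ⟨v, false⟩ : ℤ) ≤ _
    omega

end MultiClauseSet

end ClauseSets

theorem mainTheorem1 {V : Type*} [DecidableEq V] (F : ClauseSets.MultiClauseSet V)
    (hF : F.IsAutarkyFree) (hn : 0 < F.numVars) :
    (1 ≤ F.surplus ∧ F.surplus ≤ F.deficiency) ∧
    F.minVarDeg ≤ (ClauseSets.nonMersenne F.surplus.toNat : ℕ∞) ∧
    (∃ v ∈ F.vars,
      F.varDeg v ≤ ClauseSets.nonMersenne F.surplus.toNat ∧
      (F.litDeg (ClauseSets.Literal.pos v) : ℤ) ≤ F.surplus ∧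
      (F.litDeg (ClauseSets.Literal.neg v) : ℤ) ≤ F.surplus) ∧
    ((F.surplus.toNat + 1 : ℕ) : ℕ∞) ≤ F.minVarDeg ∧
    ClauseSets.nonMersenne F.surplus.toNat ≤
      F.surplus.toNat + 1 + Nat.log 2 F.surplus.toNat ∧
    F.minVarDeg ≤ (ClauseSets.nonMersenne F.deficiency.toNat : ℕ∞) ∧
    ClauseSets.nonMersenne F.deficiency.toNat ≤
      F.deficiency.toNat + 1 + Nat.log 2 F.deficiency.toNat := by
  have hne : (ClauseSets.MultiClauseSet.vars F).Nonempty := Finset.card_pos.1 hn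
  have h1 := hF.one_le_surplus hne
  have h2 := F.surplus_le_deficiency hne
  obtain ⟨v, hv, hd, hpos, hneg⟩ := hF.exists_varDeg_le hne
  have hmin : F.minVarDeg ≤ (ClauseSets.nonMersenne F.surplus.toNat : ℕ∞) :=
    (Finset.inf_le hv).trans (by exact_mod_cast hd)
  refine ⟨⟨h1, h2⟩, hmin, ⟨v, hv, hd, hpos, hneg⟩, ?_,
    ClauseSets.nonMersenne_le_log (by omega), hmin.trans ?_,
    ClauseSets.nonMersenne_le_log (by omega)⟩
  · refine Finset.le_inf fun w hw => ?_
    have := F.surplus_add_one_le_varDeg hw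
    exact Nat.cast_le.2 (by omega)
  · exact Nat.cast_le.2 (ClauseSets.nonMersenne_mono (Int.toNat_le_toNat h2))
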